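/- Let $\mathcal S\subset\mathbb Z^2$ be a finite step set all of whose steps $x=(|x|,\mathrm{alt}(x))$ have positive length $|x|>0$. Consider a finite automaton with input alphabet $\mathcal S$, finite state set $\{X_1,\dots,X_\ell\}$, initial state $X_1$ and a (partial) transition function $\delta$. A meander is a path with steps in $\mathcal S$ that starts at the origin and never attains negative altitude; let $M(t,u)$ be the generating function of the meanders that the automaton can read, and $M_j(t,u)$ that of the meanders that lead the automaton from $X_1$ to $X_j$, where $t$ encodes length (the sum of the lengths of the steps) and $u$ encodes final altitude. Let $A(t,u)$ be the adjacency matrix, $A_{ij}=\sum_{x\in\mathcal S:\ \delta(X_i,x)=X_j}t^{|x|}u^{\mathrm{alt}(x)}$, let $K(t,u)=\det(I-A(t,u))$ be the kernel, and let $u_1(t),\dots,u_e(t)$ be its small roots, i.e. all Puiseux series $u_i(t)$ over $\mathbb C$, listed with multiplicity, with $K(t,u_i(t))=0$ and $u_i(t)\to0$ as $t\to0$. Then $K$ is invertible as a power series in $t$ with coefficients in $\mathbb C[u,u^{-1}]$, and there is a polynomial $G(t,u)$ in $u$ whose coefficients are formal power series in $t$ over $\mathbb C$, such that $$M(t,u)=\frac{G(t,u)}{u^{e}K(t,u)}\prod_{i=1}^{e}(u-u_i(t)).$$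 The polynomial $G$ is characterized by $$G(t,u)\prod_{i=1}^{e}(u-u_i(t))=u^{e}\,(F_1,\dots,F_\ell)\,\mathrm{adj}(I-A(t,u))\,\vec{\mathbf 1},$$ where $(F_1,\dots,F_\ell)=(1,0,\dots,0)-\{u^{<0}\}\big((M_1,\dots,M_\ell)A(t,u)\big)$, and $\{u^{<0}\}$ denotes the part with negative powers of $u$. -/

import Mathlib

open scoped Polynomial LaurentPolynomial

noncomputable section

/-- A finite automaton that reads words over the step set `S`: it has the states `σ`, an initial
state, and a partial transition function (`none` means that the transition is not defined). There
are no final states: a word is accepted as soon as it can be read. -/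
structure PathAutomaton (S : Finset (ℤ × ℤ)) (σ : Type*) where
  /-- the initial state -/
  start : σ
  /-- the partial transition function -/
  next : σ → S → Option σ

namespace PathAutomaton

variable {S : Finset (ℤ × ℤ)} {σ : Type*}

/-- The length of a lattice path: the sum of the first coordinates of its steps. -/
def pathLength (w : List S) : ℤ := (w.map fun x => x.1.1).sum

/-- The final altitude of a lattice path: the sum of the second coordinates of its steps. -/
def altitude (w : List S) : ℤ := (w.map fun x => x.1.2).sum

/-- A (directed) path that starts at the origin is a meander if it never attains negative
altitude. -/
def IsMeander (w : List S) : Prop := ∀ p : List S, p <+: w → 0 ≤ altitude p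

/-- The state in which the automaton ends after it has read the path `w` from its initial state;
`none` if `w` cannot be read. -/
def run (A : PathAutomaton S σ) (w : List S) : Option σ := w.foldlM A.next A.start

/-- The indeterminate `u` as a unit of the ring of Laurent polynomials in `u`. -/
def uUnit (R : Type*) [CommRing R] : (R[T;T⁻¹])ˣ where
  val := LaurentPolynomial.T 1
  inv := LaurentPolynomial.T (-1)
  val_inv := by rw [← LaurentPolynomial.T_add]; simp
  inv_val := by rw [← LaurentPolynomial.T_add]; simp

/-- Formal power series in `t` whose coefficients are Laurent polynomials in `u`. -/
abbrev Biv : Type := PowerSeries ℂ[T;T⁻¹]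

/-- The variable `u` in `Biv`, as a unit. -/
def uBiv : Bivˣ := Units.map (PowerSeries.C (R := ℂ[T;T⁻¹])).toMonoidHom (uUnit ℂ)

/-- The bivariate generating function `∑ t ^ length(w) * u ^ altitude(w)` over all paths `w` with
property `P`. For a step set with positive first coordinates all the sums are finite, see
`finite_pathLength_eq`. -/
def genFun (P : List S → Prop) : Biv :=
  PowerSeries.mk fun n =>
    ∑ᶠ w ∈ {w : List S | P w ∧ pathLength w = (n : ℤ)}, LaurentPolynomial.T (altitude w)

theorem length_le_pathLength (hS : ∀ x ∈ S, 0 < x.1) (w : List S) :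
    (w.length : ℤ) ≤ pathLength w := by
  induction w with
  | nil => simp [pathLength]
  | cons x w ih =>
    have := hS x.1 x.2
    simp only [pathLength, List.map_cons, List.sum_cons, List.length_cons] at ih ⊢
    push_cast
    linarith

theorem finite_pathLength_eq (hS : ∀ x ∈ S, 0 < x.1) (P : List S → Prop) (n : ℕ) :
    {w : List S | P w ∧ pathLength w = (n : ℤ)}.Finite := by
  refine (List.finite_length_le S n).subset ?_
  rintro w ⟨-, hw⟩
  have := length_le_pathLength hS w
  change w.length ≤ n
  omega

/-- The generating function `M(t, u)` of the meanders that the automaton can read. -/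
def meanderGF (A : PathAutomaton S σ) : Biv :=
  genFun fun w => IsMeander w ∧ (A.run w).isSome

/-- The generating function of the meanders that take the automaton to the state `q`. -/
def meanderGFAt (A : PathAutomaton S σ) (q : σ) : Biv :=
  genFun fun w => IsMeander w ∧ A.run w = some q

variable [Fintype σ] [DecidableEq σ]

/-- The adjacency matrix `A(t, u)`, for elements `t` and `u` of any commutative ring: the entry at
`(p, q)` is the sum of the weights `t ^ length * u ^ altitude` of all steps that lead from the
state `p` to the state `q`. (Lengths are positive in all applications.) -/
def adjMatrix (A : PathAutomaton S σ) {R : Type*} [CommRing R] (t : R) (u : Rˣ) : Matrix σ σ R :=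
  Matrix.of fun p q =>
    ∑ x : S with A.next p x = some q, t ^ x.1.1.toNat * ((u ^ x.1.2 : Rˣ) : R)

/-- The kernel `K(t, u) = det (I - A(t, u))`. -/
def kernel (A : PathAutomaton S σ) {R : Type*} [CommRing R] (t : R) (u : Rˣ) : R :=
  (1 - A.adjMatrix t u).det

/-- The part of a series in `Biv` that consists of the terms with a negative power of `u`. -/
def negPart (f : Biv) : Biv :=
  PowerSeries.mk fun n =>
    AddMonoidAlgebra.ofCoeff ((PowerSeries.coeff n f).coeff.filter fun k => k < 0)

/-- The vector `F = (1, 0, …, 0) - {u^{<0}} ((M_q)_q * A(t, u))`, in which the entry `1` stands at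
the initial state. -/
def forbiddenVector (A : PathAutomaton S σ) (q : σ) : Biv :=
  (Pi.single A.start 1 : σ → Biv) q -
    negPart (Matrix.vecMul A.meanderGFAt (A.adjMatrix PowerSeries.X uBiv) q)

/-- The vector `adj (I - A(t, u)) * (1, …, 1)ᵀ`. -/
def adjVector (A : PathAutomaton S σ) : σ → Biv :=
  Matrix.mulVec (1 - A.adjMatrix PowerSeries.X uBiv).adjugate (fun _ => 1)

/-- Puiseux series in `t` over `ℂ`, inside the field of Hahn series with rational exponents: the
exponents have a common denominator. -/
def IsPuiseux (y : HahnSeries ℚ ℂ) : Prop :=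
  ∃ d : ℕ, 0 < d ∧ ∀ r ∈ y.support, ∃ k : ℤ, r = (k : ℚ) / (d : ℚ)

/-- The numerator of a Laurent polynomial `f`: the polynomial `u ^ N * f` with the least possible
`N : ℕ`. Its nonzero roots are the roots of `f`, with the same multiplicities. -/
def numerator {R : Type*} [CommRing R] (f : R[T;T⁻¹]) : R[X] :=
  LaurentPolynomial.trunc
    (LaurentPolynomial.T ((f.coeff.support.sup fun k => (-k).toNat : ℕ) : ℤ) * f)

/-- The kernel as a Laurent polynomial in `u` over a field that contains the Puiseux series
in `t`. -/
def kernelPuiseux (A : PathAutomaton S σ) : (HahnSeries ℚ ℂ)[T;T⁻¹] :=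
  A.kernel (LaurentPolynomial.C (HahnSeries.single 1 1)) (uUnit _)

open Classical in
/-- The small roots of the kernel, with multiplicities: the (nonzero) Puiseux series `u(t)` with
`K(t, u(t)) = 0` that tend to `0` for `t → 0`, that is, those with positive order in `t`. -/
def smallRoots (A : PathAutomaton S σ) : Multiset (HahnSeries ℚ ℂ) :=
  (numerator A.kernelPuiseux).roots.filter fun y => y ≠ 0 ∧ IsPuiseux y ∧ 0 < y.orderTop

/-- A ring that contains both `Biv` and the Puiseux series in `t`: series in `t` with rational
exponents, whose coefficients are Laurent polynomials in `u`. -/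
abbrev Ambient : Type := HahnSeries ℚ ℂ[T;T⁻¹]

/-- The inclusion of `Biv`. -/
def ofBiv : Biv →+* Ambient := HahnSeries.ofPowerSeries ℚ ℂ[T;T⁻¹]

/-- The inclusion of the series in `t` alone. -/
def ofPuiseux (y : HahnSeries ℚ ℂ) : Ambient := y.map (LaurentPolynomial.C : ℂ →+* ℂ[T;T⁻¹])

/-- The product of the factors `u - u_i(t)` over all small roots `u_i` of the kernel. -/
def smallRootProduct (A : PathAutomaton S σ) : Ambient :=
  (A.smallRoots.map fun y => ofBiv (uBiv : Biv) - ofPuiseux y).prod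

/-- A polynomial in `u` whose coefficients are power series in `t`, as an element of `Biv`. -/
def ofPoly (G : (PowerSeries ℂ)[X]) : Biv :=
  G.eval₂ (PowerSeries.map (LaurentPolynomial.C : ℂ →+* ℂ[T;T⁻¹])) (uBiv : Biv)

end PathAutomaton

end

/-! Deleting the last step of a nonempty meander gives the vector identity `(M_q)(I - A) = F`: one
more step after a meander yields either a meander or a path that has just become negative, and `F`
removes the latter. Multiplying by `adj(I - A)` and the all-ones vector gives `M * K = F · adj(I -
A) · 1`.

All weights vanish at `t = 0`, so `K = 1` modulo `t`, and `K` is invertible. Let `Q = u ^ N * K` be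
its numerator; it reduces to `u ^ N`. Weierstrass preparation gives `Q = P * H` with `P` monic of
degree `N`, `P = u ^ N` and `H = 1` modulo `t`. By Newton–Puiseux, `P` splits into factors `u - y`
with Puiseux series `y` of positive order, while `H` has no root of positive order. Hence the small
roots are exactly the roots of `P`, so `e = N` and `∏ (u - u_i) = P`.

Therefore `M * u ^ e * K = (M * H) * P`, which forces `G = M * H`. This series has no negative
powers of `u`; it is a polynomial in `u` only if its degree is bounded uniformly in `t`. The bound
comes from the other expression: `F` has only powers `≤ 0` of `u`, the adjugate has bounded degree,
and division by `P` preserves boundedness. -/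

/-! ### Hensel factorization and the Newton–Puiseux theorem over `k⟦t⟧`. -/

section NewtonPuiseux

/-- A form of Hensel's lemma: if the reduction of `f` modulo `t` is `X ^ m * g` with `g(0) ≠ 0`,
then this factorization lifts, with a monic first factor. -/
theorem exists_monic_factor_of_map_eq_X_pow_mul {k : Type*} [Field k] (f : (PowerSeries k)[X])
    (m : ℕ) (g : k[X]) (hf : f.map PowerSeries.constantCoeff = Polynomial.X ^ m * g)
    (hg : g.coeff 0 ≠ 0) :
    ∃ P H : (PowerSeries k)[X], f = P * H ∧ P.Monic ∧ P.natDegree = m ∧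
      P.map PowerSeries.constantCoeff = Polynomial.X ^ m ∧
      H.map PowerSeries.constantCoeff = g := by
  have hI : IsLocalRing.maximalIdeal (PowerSeries k) = Ideal.span {PowerSeries.X} :=
    PowerSeries.maximalIdeal_eq_span_X
  have : IsAdicComplete (IsLocalRing.maximalIdeal (PowerSeries k)) (PowerSeries k) := by
    rw [hI]; infer_instance
  have hmem : ∀ a : PowerSeries k, a ∈ IsLocalRing.maximalIdeal (PowerSeries k) ↔
      PowerSeries.constantCoeff a = 0 := fun a => by
    rw [← PowerSeries.ker_coeff_eq_max_ideal, RingHom.mem_ker]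
  have hf0 : PowerSeries.map (IsLocalRing.residue (PowerSeries k))
      (f : PowerSeries (PowerSeries k)) ≠ 0 := by
    intro h
    have h1 := congrArg (PowerSeries.coeff m) h
    simp only [PowerSeries.coeff_map, Polynomial.coeff_coe, map_zero,
      IsLocalRing.residue_eq_zero_iff, hmem] at h1
    have h2 := congrArg (fun p => Polynomial.coeff p m) hf
    rw [Polynomial.coeff_map, h1, Polynomial.coeff_X_pow_mul', if_pos le_rfl, Nat.sub_self] at h2
    exact hg h2.symm
  obtain ⟨P, h, hP⟩ := PowerSeries.exists_isWeierstrassFactorization hf0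
  have hdist := hP.isDistinguishedAt
  have hdiv := hdist.isWeierstrassDivisorAt'
  have hord : ((P : PowerSeries (PowerSeries k)).map
      (Ideal.Quotient.mk (IsLocalRing.maximalIdeal (PowerSeries k)))).order.toNat
        = P.natDegree := by
    have := congrArg ENat.toNat (hdist.coe_natDegree_eq_order_map P 1
      (by simp [hmem]) (by simp))
    simpa using this.symm
  have hPdeg : (P.degree) = (P.natDegree : WithBot ℕ) :=
    Polynomial.degree_eq_natDegree hdist.monic.ne_zero
  -- Weierstrass preparation gives the cofactor `h` only as a power series in the variable.
  -- Polynomial division by `P` is also a Weierstrass division, so uniqueness makes `h` a polynomial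
  -- and the remainder zero.
  obtain ⟨hh, hr⟩ := hdiv.eq_of_mul_add_eq_mul_add (q := h)
    (q' := ((f /ₘ P : (PowerSeries k)[X]) : PowerSeries (PowerSeries k))) (r := 0) (r' := f %ₘ P)
    (by rw [hord]; simp)
    (by rw [hord, ← hPdeg]; exact Polynomial.degree_modByMonic_lt _ hdist.monic)
    (by
      rw [Polynomial.coe_zero, add_zero, ← hP.eq_mul, ← Polynomial.coe_mul, ← Polynomial.coe_add]
      congr 1
      conv_lhs => rw [← Polynomial.modByMonic_add_div f P]
      ring)
  have hfac : f = P * (f /ₘ P) := by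
    conv_lhs => rw [← Polynomial.modByMonic_add_div f P, ← hr, zero_add]
  have hPmap : P.map PowerSeries.constantCoeff = Polynomial.X ^ P.natDegree := by
    ext i
    rw [Polynomial.coeff_map, Polynomial.coeff_X_pow]
    split_ifs with hi
    · rw [hi, hdist.monic.coeff_natDegree, map_one]
    · rcases lt_or_gt_of_ne hi with hi | hi
      · exact (hmem _).1 (hdist.mem hi)
      · rw [Polynomial.coeff_eq_zero_of_natDegree_lt hi, map_zero]
  have hH0 : ((f /ₘ P).map PowerSeries.constantCoeff).coeff 0 ≠ 0 := by
    have := PowerSeries.isUnit_iff_constantCoeff.1 hP.isUnit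
    rw [hh] at this
    have := PowerSeries.isUnit_iff_constantCoeff.1 this
    rw [Polynomial.coeff_map]
    simpa using this.ne_zero
  have hprod := hf
  rw [hfac, Polynomial.map_mul, hPmap] at hprod
  have hdeg : P.natDegree = m := by
    rcases lt_trichotomy P.natDegree m with h1 | h1 | h1
    · have := congrArg (fun p => Polynomial.coeff p P.natDegree) hprod
      simp only [Polynomial.coeff_X_pow_mul', le_refl, if_true, Nat.sub_self,
        if_neg (not_le.2 h1)] at this
      exact absurd this hH0
    · exact h1
    · have := congrArg (fun p => Polynomial.coeff p m) hprod
      simp only [Polynomial.coeff_X_pow_mul', le_refl, if_true, Nat.sub_self,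
        if_neg (not_le.2 h1)] at this
      exact absurd this.symm hg
  refine ⟨P, f /ₘ P, hfac, hdist.monic, hdeg, hdeg ▸ hPmap, ?_⟩
  rw [hdeg] at hprod
  exact mul_left_cancel₀ (pow_ne_zero _ Polynomial.X_ne_zero) hprod

/-- The Tschirnhaus transformation: a shift of the variable removes the second coefficient. -/
theorem exists_taylor_coeff_pred_eq_zero {R : Type*} [CommRing R] [Algebra ℚ R] (f : R[X])
    (hf : f.Monic) (hdeg : f.natDegree ≠ 0) :
    ∃ r : R, (Polynomial.taylor r f).coeff (f.natDegree - 1) = 0 := by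
  obtain ⟨n, hn⟩ := Nat.exists_eq_succ_of_ne_zero hdeg
  -- The shift is the mean of the roots: the degree is `n + 1`, and the shifted coefficient is
  -- `f.coeff n + (n + 1) * r`.
  refine ⟨-(algebraMap ℚ R (1 / (n + 1))) * f.coeff n, ?_⟩
  rw [hn, Nat.succ_sub_one, Polynomial.taylor_coeff]
  have hd : Polynomial.hasseDeriv n f =
      Polynomial.C (f.coeff n) + Polynomial.C ((n + 1 : ℕ) : R) * Polynomial.X := by
    ext i
    rw [Polynomial.hasseDeriv_coeff]
    rcases i with _ | _ | i
    · simp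
    · have : f.coeff (n + 1) = 1 := by
        have := hf.coeff_natDegree; rwa [hn] at this
      simp [add_comm 1 n, this]
    · rw [Polynomial.coeff_eq_zero_of_natDegree_lt (by omega : f.natDegree < i + 1 + 1 + n)]
      simp [Polynomial.coeff_one]
  rw [hd]
  have h1 : ((n + 1 : ℕ) : R) * algebraMap ℚ R (1 / (n + 1)) = 1 := by
    rw [← map_natCast (algebraMap ℚ R), ← map_mul, ← map_one (algebraMap ℚ R)]
    congr 1
    push_cast
    field_simp
  simp only [Polynomial.eval_add, Polynomial.eval_C, Polynomial.eval_mul, Polynomial.eval_X]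
  linear_combination (-(f.coeff n)) * h1

/-- The slope of the Newton polygon: after a ramification `t ↦ t ^ q`, a monic polynomial different
from `X ^ n` arises by scaling the roots of a polynomial whose reduction is not `X ^ n`. -/
theorem exists_expand_eq_scaleRoots {k : Type*} [Field k] (f : (PowerSeries k)[X]) (hf : f.Monic)
    (hne : ∃ i < f.natDegree, f.coeff i ≠ 0) :
    ∃ (q : ℕ) (hq : q ≠ 0) (p : ℕ) (g : (PowerSeries k)[X]), g.Monic ∧
      f.map (PowerSeries.expand q hq : PowerSeries k →ₐ[k] PowerSeries k).toRingHom =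
        g.scaleRoots (PowerSeries.X ^ p) ∧
      ∃ i < f.natDegree, PowerSeries.constantCoeff (g.coeff i) ≠ 0 := by
  classical
  set n := f.natDegree with hn
  set s := (Finset.range n).filter fun i => f.coeff i ≠ 0 with hs
  have hsne : s.Nonempty := by
    obtain ⟨i, hi, h⟩ := hne
    exact ⟨i, by simp [hs, hi, h]⟩
  obtain ⟨i₀, hi₀, hmin⟩ := s.exists_min_image
    (fun i => ((f.coeff i).order.toNat : ℚ) / ((n - i : ℕ) : ℚ)) hsne
  simp only [hs, Finset.mem_filter, Finset.mem_range] at hi₀ hmin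
  -- The minimal slope is `p / q`, not necessarily in lowest terms. Minimality makes `t ^ (p * (n -
  -- i))` divide the `i`-th coefficient after `t ↦ t ^ q`, exactly for `i = i₀`.
  set p := (f.coeff i₀).order.toNat
  set q := n - i₀ with hqdef
  have hq : q ≠ 0 := by omega
  have hle : ∀ i < n, PowerSeries.X ^ (p * (n - i)) ∣
      PowerSeries.expand q hq (f.coeff i) := by
    intro i hi
    by_cases h0 : f.coeff i = 0
    · simp [h0]
    have h1 := hmin i ⟨hi, h0⟩
    rw [div_le_div_iff₀ (by exact_mod_cast Nat.pos_of_ne_zero hq)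
      (by exact_mod_cast (by omega : 0 < n - i))] at h1
    have h2 : p * (n - i) ≤ q * (f.coeff i).order.toNat := by
      rw [mul_comm q]; exact_mod_cast h1
    have h3 := map_dvd (PowerSeries.expand q hq : PowerSeries k →ₐ[k] PowerSeries k)
      (PowerSeries.X_pow_order_dvd (φ := f.coeff i))
    rw [map_pow, PowerSeries.expand_X, ← pow_mul] at h3
    exact (pow_dvd_pow _ h2).trans h3
  choose! b hb using hle
  set g : (PowerSeries k)[X] := Polynomial.X ^ n +
    ∑ i ∈ Finset.range n, Polynomial.C (b i) * Polynomial.X ^ i with hg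
  have hdlt : (∑ i ∈ Finset.range n, Polynomial.C (b i) * Polynomial.X ^ i :
      (PowerSeries k)[X]).degree < n := by
    refine (Polynomial.degree_sum_le _ _).trans_lt ?_
    rw [Finset.sup_lt_iff (by exact_mod_cast WithBot.bot_lt_coe n)]
    intro i hi
    refine (Polynomial.degree_C_mul_X_pow_le _ _).trans_lt ?_
    exact_mod_cast Finset.mem_range.1 hi
  have hgm : g.Monic := Polynomial.monic_X_pow_add hdlt
  have hgn : g.natDegree = n := by
    apply Polynomial.natDegree_eq_of_degree_eq_some
    rw [hg, Polynomial.degree_add_eq_left_of_degree_lt] <;> simp [hdlt]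
  have hgc : ∀ i < n, g.coeff i = b i := by
    intro i hi
    simp [hg, Polynomial.coeff_X_pow, hi.ne, hi]
  refine ⟨q, hq, p, g, hgm, ?_, i₀, hi₀.1, ?_⟩
  · ext1 i
    rw [Polynomial.coeff_map, Polynomial.coeff_scaleRoots, hgn]
    rcases lt_trichotomy i n with hi | hi | hi
    · rw [hgc i hi, ← pow_mul, mul_comm (b i)]
      exact hb i hi
    · have h1 : g.coeff n = 1 := hgn ▸ hgm.coeff_natDegree
      have h2 : f.coeff n = 1 := hf.coeff_natDegree
      rw [hi, h1, h2]; simp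
    · rw [Polynomial.coeff_eq_zero_of_natDegree_lt (hn ▸ hi),
        Polynomial.coeff_eq_zero_of_natDegree_lt (hgn.symm ▸ hi)]
      simp
  · rw [hgc _ hi₀.1]
    have h1 := congrArg (PowerSeries.coeff (q * p)) (hb i₀ hi₀.1)
    rw [PowerSeries.coeff_expand_mul, ← hqdef, mul_comm q p, PowerSeries.coeff_X_pow_mul',
      if_pos le_rfl, Nat.sub_self] at h1
    rw [← PowerSeries.coeff_zero_eq_constantCoeff_apply, ← h1]
    exact PowerSeries.coeff_order hi₀.2

/-- **Newton–Puiseux theorem**, existence of a root: a monic polynomial over `k⟦t⟧` acquires a root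
after a ramification `t ↦ t ^ d`. -/
theorem exists_eval_map_expand_eq_zero {k : Type*} [Field k] [IsAlgClosed k] [CharZero k]
    (f : (PowerSeries k)[X]) (hf : f.Monic) (hdeg : f.natDegree ≠ 0) :
    ∃ (d : ℕ) (hd : d ≠ 0) (z : PowerSeries k),
      f.eval₂ (PowerSeries.expand d hd : PowerSeries k →ₐ[k] PowerSeries k).toRingHom z = 0 := by
  induction hN : f.natDegree using Nat.strong_induction_on generalizing f with
  | _ n ih =>
  subst hN
  obtain ⟨r, hr⟩ := exists_taylor_coeff_pred_eq_zero f hf hdeg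
  set f₁ := Polynomial.taylor r f with hf₁
  have hn₁ : f₁.natDegree = f.natDegree := Polynomial.natDegree_taylor _ _
  have hm₁ : f₁.Monic := by
    rw [Polynomial.Monic, Polynomial.leadingCoeff_taylor]; exact hf
  suffices h : ∃ (d : ℕ) (hd : d ≠ 0) (z : PowerSeries k),
      f₁.eval₂ (PowerSeries.expand d hd : PowerSeries k →ₐ[k] PowerSeries k).toRingHom z = 0 by
    obtain ⟨d, hd, z, hz⟩ := h
    refine ⟨d, hd, z + PowerSeries.expand d hd r, ?_⟩
    rw [hf₁, Polynomial.taylor_apply, Polynomial.eval₂_comp] at hz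
    simpa using hz
  by_cases hne : ∃ i < f₁.natDegree, f₁.coeff i ≠ 0
  swap
  · push Not at hne
    refine ⟨1, one_ne_zero, 0, ?_⟩
    rw [Polynomial.eval₂_at_zero, hne 0 (by omega), map_zero]
  obtain ⟨q, hq, p, g, hgm, hgs, i, hi, hgi⟩ := exists_expand_eq_scaleRoots f₁ hm₁ hne
  have hgn : g.natDegree = f.natDegree := by
    rw [← Polynomial.natDegree_scaleRoots g (PowerSeries.X ^ p), ← hgs, hm₁.natDegree_map, hn₁]
  have hgp : g.coeff (f.natDegree - 1) = 0 := by
    have h1 := congrArg (fun P => Polynomial.coeff P (f.natDegree - 1)) hgs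
    simp only [Polynomial.coeff_map, Polynomial.coeff_scaleRoots, hr, map_zero] at h1
    exact (mul_eq_zero.1 h1.symm).resolve_right
      (pow_ne_zero _ (pow_ne_zero _ PowerSeries.X_ne_zero))
  suffices h : ∃ (d : ℕ) (hd : d ≠ 0) (z : PowerSeries k),
      g.eval₂ (PowerSeries.expand d hd : PowerSeries k →ₐ[k] PowerSeries k).toRingHom z = 0 by
    obtain ⟨d, hd, z, hz⟩ := h
    refine ⟨d * q, mul_ne_zero hd hq, PowerSeries.expand d hd (PowerSeries.X ^ p) * z, ?_⟩
    have h1 := Polynomial.scaleRoots_eval₂_eq_zero _ hz (s := PowerSeries.X ^ p)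
    rw [← hgs, Polynomial.eval₂_map] at h1
    rw [← h1]
    congr 1
    ext1 a
    exact PowerSeries.expand_mul d hd q hq a
  set gb := g.map PowerSeries.constantCoeff with hgb
  have hgbm : gb.Monic := hgm.map _
  have hgbn : gb.natDegree = f.natDegree := by rw [hgm.natDegree_map, hgn]
  obtain ⟨a, ha⟩ := IsAlgClosed.exists_root gb (by
    rw [Polynomial.degree_eq_natDegree hgbm.ne_zero, hgbn]; exact_mod_cast hdeg)
  obtain ⟨h, hh, hha⟩ := Polynomial.exists_eq_pow_rootMultiplicity_mul_and_not_dvd gb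
    hgbm.ne_zero a
  set m := gb.rootMultiplicity a with hm
  have hm0 : m ≠ 0 := ((Polynomial.rootMultiplicity_pos hgbm.ne_zero).2 ha).ne'
  have hhm : h.Monic := ((Polynomial.monic_X_sub_C a).pow m).of_mul_monic_left (hh ▸ hgbm)
  have hsum : m + h.natDegree = f.natDegree := by
    rw [← hgbn, hh, ((Polynomial.monic_X_sub_C a).pow m).natDegree_mul hhm]
    simp
  -- If `a` were the only root of the reduction, it would be `(X - a) ^ n`. Its vanishing
  -- coefficient of `X ^ (n - 1)` forces `a = 0` in characteristic zero, and then `X ^ n`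
  -- contradicts the nonzero lower coefficient `hgi`.
  have hmlt : m < f.natDegree := by
    rcases (by omega : m ≤ f.natDegree).lt_or_eq with hlt | heq
    · exact hlt
    exfalso
    have h1 : h = 1 := hhm.natDegree_eq_zero.1 (by omega)
    rw [h1, mul_one, heq] at hh
    have hc := congrArg (fun P => Polynomial.coeff P (f.natDegree - 1)) hh
    simp only [hgb, Polynomial.coeff_map, hgp, map_zero, sub_eq_add_neg, ← Polynomial.C_neg,
      Polynomial.coeff_X_add_C_pow] at hc
    rw [Nat.sub_sub_self (Nat.one_le_iff_ne_zero.2 hdeg), pow_one] at hc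
    have ha0 : a = 0 := by
      rw [Nat.choose_symm (Nat.one_le_iff_ne_zero.2 hdeg), Nat.choose_one_right] at hc
      simpa [hdeg] using hc
    rw [ha0, Polynomial.C_0, sub_zero] at hh
    apply hgi
    rw [← Polynomial.coeff_map, ← hgb, hh, Polynomial.coeff_X_pow, if_neg (by omega)]
  -- Moving `a` to the origin, the factor belonging to `a` lifts to a polynomial of degree `m` below
  -- that of `f`, and the induction applies to it.
  obtain ⟨P, H, hPH, hPm, hPn, -, -⟩ := exists_monic_factor_of_map_eq_X_pow_mul
    (Polynomial.taylor (PowerSeries.C a) g) m (Polynomial.taylor a h) (by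
      rw [Polynomial.map_taylor, PowerSeries.constantCoeff_C, ← hgb, hh, Polynomial.taylor_mul,
        Polynomial.taylor_pow]
      simp) (by
      rw [Polynomial.taylor_coeff_zero]
      intro h0
      exact hha (Polynomial.dvd_iff_isRoot.2 h0))
  obtain ⟨d, hd, z, hz⟩ := ih m hmlt P hPm (hPn ▸ hm0) hPn
  refine ⟨d, hd, z + PowerSeries.C a, ?_⟩
  have h1 := congrArg (Polynomial.eval₂
    (PowerSeries.expand d hd : PowerSeries k →ₐ[k] PowerSeries k).toRingHom z) hPH
  rw [Polynomial.eval₂_mul, hz, zero_mul, Polynomial.taylor_apply, Polynomial.eval₂_comp] at h1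
  simpa [PowerSeries.expand_C] using h1

/-- **Newton–Puiseux theorem**: a monic polynomial over `k⟦t⟧` splits into linear factors after a
ramification `t ↦ t ^ d`. -/
theorem exists_map_expand_eq_prod {k : Type*} [Field k] [IsAlgClosed k] [CharZero k]
    (f : (PowerSeries k)[X]) (hf : f.Monic) :
    ∃ (d : ℕ) (hd : d ≠ 0) (Z : Multiset (PowerSeries k)),
      f.map (PowerSeries.expand d hd : PowerSeries k →ₐ[k] PowerSeries k).toRingHom =
        (Z.map fun z => Polynomial.X - Polynomial.C z).prod := by
  induction hN : f.natDegree generalizing f with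
  | zero =>
    refine ⟨1, one_ne_zero, 0, ?_⟩
    rw [hf.natDegree_eq_zero.1 hN]
    simp
  | succ n ih =>
    obtain ⟨d, hd, z, hz⟩ := exists_eval_map_expand_eq_zero f hf (by omega)
    rw [Polynomial.eval₂_eq_eval_map] at hz
    obtain ⟨g, hg⟩ := Polynomial.dvd_iff_isRoot.2 hz
    have hfm := hf.map (PowerSeries.expand d hd : PowerSeries k →ₐ[k] PowerSeries k).toRingHom
    have hgm : g.Monic := (Polynomial.monic_X_sub_C z).of_mul_monic_left (hg ▸ hfm)
    have hgn : g.natDegree = n := by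
      have h1 := (Polynomial.monic_X_sub_C z).natDegree_mul hgm
      rw [← hg, hf.natDegree_map, hN, Polynomial.natDegree_X_sub_C] at h1
      omega
    obtain ⟨d', hd', Z, hZ⟩ := ih g hgm hgn
    refine ⟨d' * d, mul_ne_zero hd' hd, PowerSeries.expand d' hd' z ::ₘ Z, ?_⟩
    rw [Multiset.map_cons, Multiset.prod_cons, ← hZ]
    have h1 := congrArg (Polynomial.map
      (PowerSeries.expand d' hd' : PowerSeries k →ₐ[k] PowerSeries k).toRingHom) hg
    rw [Polynomial.map_map, Polynomial.map_mul, Polynomial.map_sub, Polynomial.map_X,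
      Polynomial.map_C] at h1
    refine Eq.trans ?_ h1
    congr 1
    ext1 a
    exact PowerSeries.expand_mul d' hd' d hd a

end NewtonPuiseux

/-! ### Generating functions of paths and the last-step decomposition. -/

namespace PathAutomaton

variable {S : Finset (ℤ × ℤ)} {σ : Type*}

@[simp]
theorem val_uUnit_zpow (R : Type*) [CommRing R] (k : ℤ) :
    ((uUnit R ^ k : (R[T;T⁻¹])ˣ) : R[T;T⁻¹]) = LaurentPolynomial.T k := by
  have hnat : ∀ n : ℕ, ((uUnit R ^ n : (R[T;T⁻¹])ˣ) : R[T;T⁻¹]) = LaurentPolynomial.T n := by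
    intro n
    rw [Units.val_pow_eq_pow_val, uUnit, LaurentPolynomial.T_pow, mul_one]
  rcases k with n | n
  · rw [Int.ofNat_eq_natCast, zpow_natCast, hnat]
  · rw [zpow_negSucc]
    refine Units.inv_eq_of_mul_eq_one_left ?_
    rw [hnat, ← LaurentPolynomial.T_add]
    simp [Int.negSucc_eq]

theorem val_uBiv_zpow (k : ℤ) :
    ((uBiv ^ k : Bivˣ) : Biv) = PowerSeries.C (LaurentPolynomial.T k) := by
  rw [uBiv, ← map_zpow, Units.coe_map, val_uUnit_zpow]
  rfl

section GeneratingFunctions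

/-- All paths of length `n`. -/
noncomputable def pathsOfLength (hS : ∀ x ∈ S, 0 < x.1) (n : ℕ) : Finset (List S) :=
  (finite_pathLength_eq hS (fun _ => True) n).toFinset

theorem mem_pathsOfLength (hS : ∀ x ∈ S, 0 < x.1) (n : ℕ) (w : List S) :
    w ∈ pathsOfLength hS n ↔ pathLength w = n := by
  simp [pathsOfLength]

open Classical in
theorem coeff_genFun (hS : ∀ x ∈ S, 0 < x.1) (P : List S → Prop) (n : ℕ) :
    PowerSeries.coeff n (genFun P) =
      ∑ w ∈ pathsOfLength hS n, if P w then LaurentPolynomial.T (altitude w) else 0 := by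
  rw [genFun, PowerSeries.coeff_mk, ← Finset.sum_filter]
  refine finsum_mem_eq_sum_of_inter_support_eq _ ?_
  congr 1
  ext w
  simp [mem_pathsOfLength, and_comm]

theorem genFun_congr {P Q : List S → Prop} (h : ∀ w, P w ↔ Q w) : genFun P = genFun Q := by
  rw [show P = Q from funext fun w => propext (h w)]

theorem genFun_or (hS : ∀ x ∈ S, 0 < x.1) {P Q : List S → Prop} (h : ∀ w, P w → ¬ Q w) :
    genFun (fun w => P w ∨ Q w) = genFun P + genFun Q := by
  classical
  ext1 n
  rw [map_add, coeff_genFun hS, coeff_genFun hS, coeff_genFun hS, ← Finset.sum_add_distrib]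
  refine Finset.sum_congr rfl fun w _ => ?_
  by_cases hP : P w
  · simp [hP, h w hP]
  · simp [hP]

theorem genFun_exists (hS : ∀ x ∈ S, 0 < x.1) {ι : Type*} [Fintype ι] {P : ι → List S → Prop}
    (h : ∀ w i j, P i w → P j w → i = j) :
    genFun (fun w => ∃ i, P i w) = ∑ i, genFun (P i) := by
  classical
  ext1 n
  simp only [map_sum, coeff_genFun hS]
  rw [Finset.sum_comm]
  refine Finset.sum_congr rfl fun w _ => ?_
  by_cases hP : ∃ i, P i w
  · obtain ⟨i, hi⟩ := hP
    rw [if_pos ⟨i, hi⟩, Finset.sum_eq_single i, if_pos hi]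
    · intro j _ hj
      rw [if_neg fun h' => hj (h w _ _ h' hi)]
    · simp
  · rw [if_neg hP, Finset.sum_eq_zero]
    intro i _
    rw [if_neg fun h' => hP ⟨i, h'⟩]

theorem genFun_and_const (P : List S → Prop) (c : Prop) [Decidable c] :
    genFun (fun w => P w ∧ c) = if c then genFun P else 0 := by
  split_ifs with hc
  · exact genFun_congr fun w => by simp [hc]
  · ext1 n
    simp [genFun, hc]

theorem genFun_nil : genFun (fun w : List S => w = []) = 1 := by
  ext1 n
  rw [genFun, PowerSeries.coeff_mk, PowerSeries.coeff_one]
  split_ifs with hn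
  · subst hn
    rw [show {w : List S | w = [] ∧ pathLength w = ((0 : ℕ) : ℤ)} = {[]} by
      ext w
      simp only [Set.mem_ofPred_eq, Set.mem_singleton_iff, and_iff_left_iff_imp]
      rintro rfl
      simp [pathLength]]
    rw [finsum_mem_singleton]
    simp [altitude]
  · rw [show {w : List S | w = [] ∧ pathLength w = (n : ℤ)} = ∅ by
      ext w
      simp only [Set.mem_ofPred_eq, Set.mem_empty_iff_false, iff_false, not_and]
      rintro rfl
      simpa [pathLength, eq_comm] using hn]
    simp

/-- The part with negative powers of `u` of a Laurent polynomial. -/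
noncomputable def laurentNegPart : ℂ[T;T⁻¹] →+ ℂ[T;T⁻¹] where
  toFun f := AddMonoidAlgebra.ofCoeff (f.coeff.filter fun k => k < 0)
  map_zero' := by ext; simp [Finsupp.filter_zero]
  map_add' f g := by ext; simp [Finsupp.filter_add]

theorem coeff_negPart (f : Biv) (n : ℕ) :
    PowerSeries.coeff n (negPart f) = laurentNegPart (PowerSeries.coeff n f) := by
  rw [negPart, PowerSeries.coeff_mk]
  rfl

theorem laurentNegPart_T (k : ℤ) :
    laurentNegPart (LaurentPolynomial.T k) = if k < 0 then LaurentPolynomial.T k else 0 := by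
  ext j
  simp only [laurentNegPart, AddMonoidHom.coe_mk, ZeroHom.coe_mk, Finsupp.filter_apply]
  by_cases hk : k < 0 <;> by_cases hj : j < 0 <;> simp [hk, hj] <;> intro h <;> omega

theorem negPart_genFun (hS : ∀ x ∈ S, 0 < x.1) (P : List S → Prop) :
    negPart (genFun P) = genFun fun w => P w ∧ altitude w < 0 := by
  classical
  ext1 n
  rw [coeff_negPart, coeff_genFun hS, coeff_genFun hS, map_sum]
  refine Finset.sum_congr rfl fun w _ => ?_
  by_cases hP : P w <;> simp [hP, laurentNegPart_T]

theorem pathLength_concat (v : List S) (x : S) :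
    pathLength (v ++ [x]) = pathLength v + x.1.1 := by
  simp [pathLength]

theorem altitude_concat (v : List S) (x : S) : altitude (v ++ [x]) = altitude v + x.1.2 := by
  simp [altitude]

theorem genFun_concat (hS : ∀ x ∈ S, 0 < x.1) (P : List S → Prop) (x : S) :
    genFun (fun w => ∃ v, w = v ++ [x] ∧ P v) =
      genFun P * (PowerSeries.X ^ x.1.1.toNat * ((uBiv ^ x.1.2 : Bivˣ) : Biv)) := by
  classical
  have hx := hS x.1 x.2
  ext1 n
  rw [val_uBiv_zpow, ← mul_assoc, PowerSeries.coeff_mul_C, PowerSeries.coeff_mul_X_pow']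
  split_ifs with hn
  · rw [coeff_genFun hS, coeff_genFun hS, Finset.sum_mul, ← Finset.sum_filter]
    simp_rw [ite_mul, zero_mul]
    rw [← Finset.sum_filter]
    symm
    refine Finset.sum_bij (fun v _ => v ++ [x]) ?_ ?_ ?_ ?_
    · intro v hv
      simp only [Finset.mem_filter, mem_pathsOfLength] at hv ⊢
      refine ⟨?_, v, rfl, hv.2⟩
      rw [pathLength_concat, hv.1]
      omega
    · intro v _ v' _ h
      exact List.append_cancel_right h
    · intro w hw
      simp only [Finset.mem_filter, mem_pathsOfLength] at hw
      obtain ⟨hw, v, rfl, hv⟩ := hw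
      refine ⟨v, ?_, rfl⟩
      rw [pathLength_concat] at hw
      simp only [Finset.mem_filter, mem_pathsOfLength]
      exact ⟨by omega, hv⟩
    · intro v _
      rw [altitude_concat, LaurentPolynomial.T_add]
  · rw [zero_mul, coeff_genFun hS]
    refine Finset.sum_eq_zero fun w hw => ?_
    rw [if_neg]
    rintro ⟨v, rfl, -⟩
    rw [mem_pathsOfLength, pathLength_concat] at hw
    have := length_le_pathLength hS v
    omega

end GeneratingFunctions

theorem isMeander_nil : IsMeander ([] : List S) := by
  intro p hp
  rw [List.prefix_nil.1 hp]
  simp [altitude]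

theorem IsMeander.altitude_nonneg {w : List S} (h : IsMeander w) : 0 ≤ altitude w :=
  h w (List.prefix_refl w)

theorem isMeander_concat (v : List S) (x : S) :
    IsMeander (v ++ [x]) ↔ IsMeander v ∧ 0 ≤ altitude (v ++ [x]) := by
  simp only [IsMeander, List.prefix_concat_iff]
  constructor
  · intro h
    exact ⟨fun p hp => h p (Or.inr hp), h _ (Or.inl rfl)⟩
  · rintro ⟨h1, h2⟩ p (rfl | hp)
    · exact h2
    · exact h1 p hp

theorem run_concat (A : PathAutomaton S σ) (v : List S) (x : S) (q : σ) :
    A.run (v ++ [x]) = some q ↔ ∃ p, A.run v = some p ∧ A.next p x = some q := by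
  simp [run, List.foldlM_append, Option.bind_eq_some_iff]

theorem sum_meanderGFAt [Fintype σ] (hS : ∀ x ∈ S, 0 < x.1) (A : PathAutomaton S σ) :
    ∑ q, A.meanderGFAt q = A.meanderGF := by
  unfold meanderGFAt meanderGF
  rw [← genFun_exists hS]
  · exact genFun_congr fun w => by simp [Option.isSome_iff_exists]
  · rintro w i j ⟨-, hi⟩ ⟨-, hj⟩
    exact Option.some_injective _ (hi.symm.trans hj)

variable [Fintype σ] [DecidableEq σ]

/-- The last step of a path is unique and the automaton is deterministic, so each extended path is
counted once. The added step may lead below zero. -/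
theorem vecMul_meanderGFAt_adjMatrix (hS : ∀ x ∈ S, 0 < x.1) (A : PathAutomaton S σ) (q : σ) :
    Matrix.vecMul A.meanderGFAt (A.adjMatrix PowerSeries.X uBiv) q =
      genFun fun w => ∃ x v, w = v ++ [x] ∧
        ∃ p, (IsMeander v ∧ A.run v = some p) ∧ A.next p x = some q := by
  rw [genFun_exists hS]
  · simp_rw [genFun_concat hS]
    have h : ∀ x : S, genFun (fun v => ∃ p, (IsMeander v ∧ A.run v = some p) ∧
        A.next p x = some q) = ∑ p, if A.next p x = some q then A.meanderGFAt p else 0 := by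
      intro x
      rw [genFun_exists hS]
      · simp_rw [genFun_and_const]
        rfl
      · rintro w i j ⟨⟨-, hi⟩, -⟩ ⟨⟨-, hj⟩, -⟩
        exact Option.some_injective _ (hi.symm.trans hj)
    simp_rw [h, Finset.sum_mul, ite_mul, zero_mul]
    rw [Finset.sum_comm]
    simp only [Matrix.vecMul, dotProduct, adjMatrix, Matrix.of_apply, Finset.mul_sum,
      Finset.sum_filter, mul_ite, mul_zero]
  · rintro w i j ⟨v, rfl, -⟩ ⟨v', h, -⟩
    simpa using (List.append_inj' h rfl).2

/-- The step-by-step decomposition of meanders. -/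
theorem vecMul_meanderGFAt (hS : ∀ x ∈ S, 0 < x.1) (A : PathAutomaton S σ) :
    Matrix.vecMul A.meanderGFAt (1 - A.adjMatrix PowerSeries.X uBiv) = A.forbiddenVector := by
  funext q
  rw [Matrix.vecMul_sub, Matrix.vecMul_one, Pi.sub_apply, forbiddenVector,
    vecMul_meanderGFAt_adjMatrix hS]
  set B : List S → Prop := fun w => ∃ x v, w = v ++ [x] ∧
        ∃ p, (IsMeander v ∧ A.run v = some p) ∧ A.next p x = some q with hB
  have hsplit : genFun B = genFun (fun w => B w ∧ altitude w < 0) +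
      genFun (fun w => B w ∧ ¬ altitude w < 0) := by
    rw [← genFun_or hS fun w h h' => h'.2 h.2]
    exact genFun_congr fun w => by by_cases h : altitude w < 0 <;> simp [h]
  -- A meander is empty or an extended meander with nonnegative final altitude; the other half of
  -- `hsplit` is the part that `F` subtracts.
  have hM : A.meanderGFAt q = genFun (fun w : List S => w = [] ∧ A.start = q) +
      genFun (fun w => B w ∧ ¬ altitude w < 0) := by
    rw [← genFun_or hS]
    · refine genFun_congr fun w => ?_
      rcases List.eq_nil_or_concat w with rfl | ⟨v, x, rfl⟩
      · simp [isMeander_nil, run, hB]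
      · simp only [List.concat_eq_append, isMeander_concat, run_concat, hB, not_lt,
          List.append_eq_nil_iff, List.cons_ne_nil, and_false, false_and, false_or]
        constructor
        · rintro ⟨⟨h1, h2⟩, p, h3, h4⟩
          exact ⟨⟨x, v, rfl, p, ⟨h1, h3⟩, h4⟩, h2⟩
        · rintro ⟨⟨x', v', h, p, ⟨h1, h3⟩, h4⟩, h2⟩
          obtain ⟨rfl, h'⟩ := List.append_inj' h rfl
          obtain rfl : x = x' := by simpa using h'
          exact ⟨⟨h1, h2⟩, p, h3, h4⟩
    · rintro w ⟨rfl, -⟩ ⟨⟨x, v, h, -⟩, -⟩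
      simp at h
  rw [hM, negPart_genFun hS, genFun_and_const, genFun_nil, hsplit]
  clear_value B
  by_cases hq : A.start = q
  · subst hq
    simp
  · simp [hq, Ne.symm hq]

/-- Since `(I - A) * adj(I - A) = K * I`, the last-step identity turns the left side into `K` times
the sum of the `M_q`. -/
theorem forbiddenVector_dotProduct_adjVector (hS : ∀ x ∈ S, 0 < x.1) (A : PathAutomaton S σ) :
    A.forbiddenVector ⬝ᵥ A.adjVector = A.meanderGF * A.kernel PowerSeries.X uBiv := by
  rw [← vecMul_meanderGFAt hS, adjVector, ← Matrix.dotProduct_mulVec, Matrix.mulVec_mulVec,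
    Matrix.mul_adjugate, Matrix.smul_mulVec, Matrix.one_mulVec, dotProduct_smul,
    ← sum_meanderGFAt hS, kernel, smul_eq_mul, mul_comm]
  simp [dotProduct]

end PathAutomaton

/-! ### Ramification and orders of Hahn series with rational exponents. -/

section HahnSeries

open HahnSeries in
theorem HahnSeries.coeff_ofPowerSeries_of_notMem_range {R : Type*} [Semiring R] (f : PowerSeries R)
    {r : ℚ} (hr : r ∉ Set.range ((↑) : ℕ → ℚ)) : (ofPowerSeries ℚ R f).coeff r = 0 := by
  rw [ofPowerSeries_apply]
  exact embDomain_of_notMem_range hr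

theorem HahnSeries.orderTop_ofPowerSeries_nonneg {R : Type*} [Semiring R] (f : PowerSeries R) :
    0 ≤ (ofPowerSeries ℚ R f).orderTop := by
  rw [le_orderTop_iff_forall]
  intro r hr
  refine coeff_ofPowerSeries_of_notMem_range f ?_
  rintro ⟨n, rfl⟩
  have : ((n : ℕ) : ℚ) < 0 := by exact_mod_cast hr
  exact absurd this (not_lt.2 n.cast_nonneg)

/-- The ramification `t ↦ t ^ q` of Hahn series with rational exponents. -/
noncomputable def HahnSeries.ramify (k : Type*) [Semiring k] (q : ℚ) (hq : 0 < q) :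
    HahnSeries ℚ k →+* HahnSeries ℚ k :=
  embDomainRingHom (AddMonoidHom.mulRight q) (mul_left_injective₀ hq.ne')
    fun _ _ => mul_le_mul_iff_left₀ hq

theorem HahnSeries.coeff_ramify {k : Type*} [Semiring k] (q : ℚ) (hq : 0 < q)
    (x : HahnSeries ℚ k) (r : ℚ) : (ramify k q hq x).coeff r = x.coeff (r / q) := by
  conv_lhs => rw [show r = AddMonoidHom.mulRight q (r / q) by simp [hq.ne']]
  exact embDomain_mk_coeff _ _

/-- Substituting `t ^ (1 / d)` undoes `t ↦ t ^ d`. This carries a splitting of the ramified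
polynomial back to the original one, with roots in `t ^ (1 / d)`. -/
theorem HahnSeries.ramify_ofPowerSeries_expand {k : Type*} [CommRing k] (d : ℕ) (hd : d ≠ 0)
    (f : PowerSeries k) :
    ramify k (1 / d) (by positivity) (ofPowerSeries ℚ k (PowerSeries.expand d hd f)) =
      ofPowerSeries ℚ k f := by
  have hd' : (d : ℚ) ≠ 0 := by exact_mod_cast hd
  ext r
  rw [coeff_ramify, div_div_eq_mul_div, div_one]
  by_cases hr : r ∈ Set.range ((↑) : ℕ → ℚ)
  · obtain ⟨n, rfl⟩ := hr
    rw [show (n : ℚ) * d = ((d * n : ℕ) : ℚ) by push_cast; ring, ofPowerSeries_apply_coeff,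
      ofPowerSeries_apply_coeff, PowerSeries.coeff_expand_mul]
  · rw [coeff_ofPowerSeries_of_notMem_range f hr]
    by_cases hr' : r * d ∈ Set.range ((↑) : ℕ → ℚ)
    · obtain ⟨m, hm⟩ := hr'
      rw [← hm, ofPowerSeries_apply_coeff]
      refine PowerSeries.coeff_expand_of_not_dvd d hd f ?_
      rintro ⟨n, rfl⟩
      refine hr ⟨n, ?_⟩
      push_cast at hm
      rw [mul_comm] at hm
      exact mul_right_cancel₀ hd' hm
    · exact coeff_ofPowerSeries_of_notMem_range _ hr'

theorem HahnSeries.isPuiseux_ramify (d : ℕ) (hd : d ≠ 0) (z : PowerSeries ℂ) :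
    PathAutomaton.IsPuiseux (ramify ℂ (1 / d) (by positivity) (ofPowerSeries ℚ ℂ z)) := by
  have hd' : (d : ℚ) ≠ 0 := by exact_mod_cast hd
  refine ⟨d, Nat.pos_of_ne_zero hd, fun r hr => ?_⟩
  rw [mem_support, coeff_ramify, div_div_eq_mul_div, div_one] at hr
  by_contra h
  refine hr (coeff_ofPowerSeries_of_notMem_range z ?_)
  rintro ⟨n, hn⟩
  exact h ⟨n, by push_cast; rw [hn, mul_div_cancel_right₀ _ hd']⟩

theorem HahnSeries.zero_lt_orderTop_ramify {k : Type*} [Semiring k] (q : ℚ) (hq : 0 < q)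
    (z : PowerSeries k) (hz : PowerSeries.constantCoeff z = 0) :
    0 < (ramify k q hq (ofPowerSeries ℚ k z)).orderTop := by
  by_contra h
  rw [not_lt] at h
  set y := ramify k q hq (ofPowerSeries ℚ k z) with hy
  have hy0 : y ≠ 0 := by
    intro h0
    rw [h0, orderTop_zero] at h
    simp at h
  have hord : (y.order : WithTop ℚ) ≤ 0 := by rwa [order_eq_orderTop_of_ne_zero hy0]
  have hord' : y.order ≤ 0 := by exact_mod_cast hord
  have hc := (coeff_order_eq_zero (x := y)).not.2 hy0
  apply hc
  rw [hy, coeff_ramify, ← hy]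
  by_cases hr : y.order / q ∈ Set.range ((↑) : ℕ → ℚ)
  · obtain ⟨n, hn⟩ := hr
    have h1 : (n : ℚ) ≤ 0 := hn ▸ div_nonpos_of_nonpos_of_nonneg hord' hq.le
    have h2 : n = 0 := by exact_mod_cast le_antisymm h1 n.cast_nonneg
    rw [← hn, ofPowerSeries_apply_coeff, h2, PowerSeries.coeff_zero_eq_constantCoeff_apply, hz]
  · exact coeff_ofPowerSeries_of_notMem_range _ hr

/-- If the reduction of `H` modulo `t` is `1`, then `H` has no roots of positive order. -/
theorem HahnSeries.eval_map_ofPowerSeries_ne_zero {k : Type*} [CommRing k] [Nontrivial k]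
    (H : (PowerSeries k)[X])
    (hH : H.map PowerSeries.constantCoeff = 1) (y : HahnSeries ℚ k) (hy : 0 < y.orderTop) :
    (H.map (ofPowerSeries ℚ k)).eval y ≠ 0 := by
  intro h
  have h0 := congrArg (fun x => coeff x 0) h
  simp only [Polynomial.eval_map, Polynomial.eval₂_eq_sum_range, coeff_sum, coeff_zero] at h0
  -- Terms with a positive power of `y` have positive order, so the coefficient at `t ^ 0` is that
  -- of `H.coeff 0`, namely `1`.
  rw [Finset.sum_eq_single 0] at h0
  · have h1 := ofPowerSeries_apply_coeff (Γ := ℚ) (H.coeff 0) 0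
    rw [Nat.cast_zero] at h1
    rw [pow_zero, mul_one, h1, PowerSeries.coeff_zero_eq_constantCoeff_apply, ← Polynomial.coeff_map, hH] at h0
    simp at h0
  · intro i _ hi
    obtain ⟨j, rfl⟩ := Nat.exists_eq_succ_of_ne_zero hi
    refine coeff_eq_zero_of_lt_orderTop ?_
    rw [pow_succ, ← mul_assoc]
    have h1 : 0 ≤ (y ^ j).orderTop :=
      (nsmul_nonneg hy.le j).trans orderTop_nsmul_le_orderTop_pow
    have h2 := (add_nonneg (orderTop_ofPowerSeries_nonneg (H.coeff (j + 1))) h1).trans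
      orderTop_add_le_mul
    exact (hy.trans_le (le_add_of_nonneg_left h2)).trans_le orderTop_add_le_mul
  · simp

end HahnSeries

/-! ### Splitting of distinguished polynomials over the Puiseux series. -/

section Puiseux

/-- The roots of a distinguished polynomial over `ℂ⟦t⟧` are Puiseux series of positive order. -/
theorem exists_map_ofPowerSeries_eq_prod (P : (PowerSeries ℂ)[X]) (hP : P.Monic) (m : ℕ)
    (hPm : P.map PowerSeries.constantCoeff = Polynomial.X ^ m) :
    ∃ Y : Multiset (HahnSeries ℚ ℂ),
      P.map (HahnSeries.ofPowerSeries ℚ ℂ) = (Y.map fun y => Polynomial.X - Polynomial.C y).prod ∧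
      ∀ y ∈ Y, PathAutomaton.IsPuiseux y ∧ 0 < y.orderTop := by
  obtain ⟨d, hd, Z, hZ⟩ := exists_map_expand_eq_prod P hP
  refine ⟨Z.map fun z => HahnSeries.ramify ℂ (1 / d) (by positivity)
    (HahnSeries.ofPowerSeries ℚ ℂ z), ?_, ?_⟩
  · have h1 := congrArg (Polynomial.map ((HahnSeries.ramify ℂ (1 / d) (by positivity)).comp
      (HahnSeries.ofPowerSeries ℚ ℂ))) hZ
    rw [Polynomial.map_map, Polynomial.map_multiset_prod, Multiset.map_map] at h1
    rw [Multiset.map_map]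
    refine Eq.trans ?_ (h1.trans ?_)
    · congr 1
      ext1 f
      exact (HahnSeries.ramify_ofPowerSeries_expand d hd f).symm
    · congr 1
      refine Multiset.map_congr rfl fun z _ => ?_
      simp
  · intro y hy
    obtain ⟨z, hz, rfl⟩ := Multiset.mem_map.1 hy
    refine ⟨HahnSeries.isPuiseux_ramify d hd z, HahnSeries.zero_lt_orderTop_ramify _ _ z ?_⟩
    -- Ramification preserves constant coefficients, so the constant term of a root is a root of `X
    -- ^ m`, hence zero.
    have h1 := congrArg (fun p => (p.map PowerSeries.constantCoeff).eval
      (PowerSeries.constantCoeff z)) hZ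
    simp only [Polynomial.map_map] at h1
    rw [show PowerSeries.constantCoeff.comp
        (PowerSeries.expand d hd : PowerSeries ℂ →ₐ[ℂ] PowerSeries ℂ).toRingHom =
        PowerSeries.constantCoeff from
      RingHom.ext fun a => PowerSeries.constantCoeff_expand d hd a, hPm,
      Polynomial.eval_pow, Polynomial.eval_X, Polynomial.eval_map_apply,
      Polynomial.eval_multiset_prod, Multiset.prod_eq_zero, map_zero] at h1
    · by_contra h
      exact pow_ne_zero m h h1
    · rw [Multiset.map_map]
      exact Multiset.mem_map.2 ⟨z, hz, by simp⟩

end Puiseux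

/-! ### Numerators of Laurent polynomials and the factorization of the kernel. -/

namespace PathAutomaton

section Laurent

theorem coeff_T_mul {R : Type*} [CommRing R] (k : ℤ) (f : R[T;T⁻¹]) (j : ℤ) :
    (LaurentPolynomial.T k * f).coeff j = f.coeff (j - k) := by
  rw [LaurentPolynomial.T, AddMonoidAlgebra.coeff_single_mul_apply, one_mul]
  congr 1
  ring

theorem coeff_trunc {R : Type*} [CommRing R] (f : R[T;T⁻¹]) (n : ℕ) :
    (LaurentPolynomial.trunc f).coeff n = f.coeff (n : ℤ) := rfl

theorem coeff_toLaurent_natCast {R : Type*} [CommRing R] (p : R[X]) (n : ℕ) :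
    (Polynomial.toLaurent p).coeff (n : ℤ) = p.coeff n := by
  rw [← coeff_trunc, Polynomial.trunc_toLaurent]

theorem coeff_toLaurent_of_neg {R : Type*} [CommRing R] (p : R[X]) {k : ℤ} (hk : k < 0) :
    (Polynomial.toLaurent p).coeff k = 0 := by
  rw [← Finsupp.notMem_support_iff, LaurentPolynomial.support_coeff_toLaurent]
  simp only [Finset.mem_map, not_exists, not_and]
  rintro n - rfl
  exact absurd hk (not_lt.2 (Int.natCast_nonneg n))

/-- The exponent `N` in the definition of the numerator. -/
def numeratorExponent {R : Type*} [CommRing R] (f : R[T;T⁻¹]) : ℕ :=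
  f.coeff.support.sup fun k => (-k).toNat

theorem coeff_numerator {R : Type*} [CommRing R] (f : R[T;T⁻¹]) (n : ℕ) :
    (numerator f).coeff n = f.coeff (n - numeratorExponent f) := by
  rw [numerator, coeff_trunc, coeff_T_mul]
  rfl

/-- The exponent clears every negative power, so the truncation loses nothing. -/
theorem toLaurent_numerator {R : Type*} [CommRing R] (f : R[T;T⁻¹]) :
    Polynomial.toLaurent (numerator f) = LaurentPolynomial.T (numeratorExponent f : ℤ) * f := by
  ext k
  rw [coeff_T_mul]
  by_cases hk : 0 ≤ k
  · lift k to ℕ using hk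
    rw [← coeff_numerator, coeff_toLaurent_natCast]
  · rw [coeff_toLaurent_of_neg _ (not_le.1 hk)]
    by_contra h
    have h2 : (-(k - numeratorExponent f)).toNat ≤ numeratorExponent f :=
      Finset.le_sup (f := fun k : ℤ => (-k).toNat) (Finsupp.mem_support_iff.2 (Ne.symm h))
    omega

/-- A positive exponent is attained at some `-k` with `k` in the support; exponent zero leaves
`f.coeff 0`. For the kernel this rules out the root `0`. -/
theorem numerator_coeff_zero_ne_zero {R : Type*} [CommRing R] (f : R[T;T⁻¹])
    (hf : f.coeff 0 ≠ 0) : (numerator f).coeff 0 ≠ 0 := by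
  obtain ⟨k, hk, hN⟩ := Finset.exists_mem_eq_sup f.coeff.support
    ⟨0, Finsupp.mem_support_iff.2 hf⟩ fun k => (-k).toNat
  rw [coeff_numerator]
  change numeratorExponent f = (-k).toNat at hN
  by_cases h0 : numeratorExponent f = 0
  · simpa [h0] using hf
  · rw [show (((0 : ℕ) : ℤ) - numeratorExponent f) = k by omega]
    exact Finsupp.mem_support_iff.1 hk

theorem coeff_mapRingHom {R R' : Type*} [CommRing R] [CommRing R'] (φ : R →+* R') (f : R[T;T⁻¹])
    (k : ℤ) : (AddMonoidAlgebra.mapRingHom ℤ φ f).coeff k = φ (f.coeff k) := rfl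

/-- Injectivity keeps the support, and hence the exponent, unchanged. -/
theorem map_numerator {R R' : Type*} [CommRing R] [CommRing R'] (φ : R →+* R')
    (hφ : Function.Injective φ) (f : R[T;T⁻¹]) :
    (numerator f).map φ = numerator (AddMonoidAlgebra.mapRingHom ℤ φ f) := by
  have hN : numeratorExponent (AddMonoidAlgebra.mapRingHom ℤ φ f) = numeratorExponent f := by
    unfold numeratorExponent
    congr 1
    ext k
    rw [Finsupp.mem_support_iff, Finsupp.mem_support_iff, coeff_mapRingHom,
      map_ne_zero_iff φ hφ]
  ext1 n
  rw [Polynomial.coeff_map, coeff_numerator, coeff_numerator, hN, coeff_mapRingHom]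

theorem map_uUnit {R R' : Type*} [CommRing R] [CommRing R'] (φ : R →+* R') :
    Units.map (AddMonoidAlgebra.mapRingHom ℤ φ : R[T;T⁻¹] →+* R'[T;T⁻¹]).toMonoidHom (uUnit R) =
      uUnit R' := by
  ext1
  ext k
  simp [uUnit]

end Laurent

variable {S : Finset (ℤ × ℤ)} {σ : Type*} [DecidableEq σ]

theorem map_adjMatrix (A : PathAutomaton S σ) {R R' : Type*} [CommRing R] [CommRing R']
    (φ : R →+* R') (t : R) (u : Rˣ) :
    (A.adjMatrix t u).map φ = A.adjMatrix (φ t) (Units.map φ.toMonoidHom u) := by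
  ext p q
  simp [adjMatrix, ← map_zpow]

variable [Fintype σ]

theorem map_kernel (A : PathAutomaton S σ) {R R' : Type*} [CommRing R] [CommRing R']
    (φ : R →+* R') (t : R) (u : Rˣ) :
    φ (A.kernel t u) = A.kernel (φ t) (Units.map φ.toMonoidHom u) := by
  rw [kernel, kernel, RingHom.map_det, map_sub, map_one, RingHom.mapMatrix_apply, map_adjMatrix]

theorem kernel_zero (hS : ∀ x ∈ S, 0 < x.1) (A : PathAutomaton S σ) {R : Type*} [CommRing R]
    (u : Rˣ) : A.kernel 0 u = 1 := by
  have h : A.adjMatrix 0 u = 0 := by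
    ext p q
    refine Finset.sum_eq_zero fun x _ => ?_
    have := hS x.1 x.2
    rw [zero_pow (by omega), zero_mul]
  rw [kernel, h, sub_zero, Matrix.det_one]

/-- The kernel as a Laurent polynomial in `u` over the power series in `t`. -/
noncomputable def kernelLaurent (A : PathAutomaton S σ) : (PowerSeries ℂ)[T;T⁻¹] :=
  A.kernel (LaurentPolynomial.C PowerSeries.X) (uUnit _)

theorem mapRingHom_C {R R' : Type*} [CommRing R] [CommRing R'] (φ : R →+* R') (a : R) :
    AddMonoidAlgebra.mapRingHom ℤ φ (LaurentPolynomial.C a) = LaurentPolynomial.C (φ a) := by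
  ext k
  simp [apply_ite φ]

theorem map_kernelLaurent (A : PathAutomaton S σ) :
    AddMonoidAlgebra.mapRingHom ℤ (HahnSeries.ofPowerSeries ℚ ℂ) A.kernelLaurent =
      A.kernelPuiseux := by
  rw [kernelLaurent, map_kernel, kernelPuiseux, map_uUnit, mapRingHom_C,
    HahnSeries.ofPowerSeries_X]

theorem constantCoeff_kernelLaurent (hS : ∀ x ∈ S, 0 < x.1) (A : PathAutomaton S σ) :
    AddMonoidAlgebra.mapRingHom ℤ PowerSeries.constantCoeff A.kernelLaurent = 1 := by
  rw [kernelLaurent, map_kernel, map_uUnit, mapRingHom_C, PowerSeries.constantCoeff_X, map_zero,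
    kernel_zero hS]

theorem constantCoeff_coeff_kernelLaurent (hS : ∀ x ∈ S, 0 < x.1) (A : PathAutomaton S σ) (k : ℤ) :
    PowerSeries.constantCoeff (A.kernelLaurent.coeff k) = if k = 0 then 1 else 0 := by
  rw [← coeff_mapRingHom, constantCoeff_kernelLaurent hS, ← map_one LaurentPolynomial.C,
    LaurentPolynomial.C_apply]

/-- The inclusion of the Laurent polynomials in `u` over the power series in `t` into `Biv`. -/
noncomputable def laurentToBiv : (PowerSeries ℂ)[T;T⁻¹] →+* Biv :=
  LaurentPolynomial.eval₂ (PowerSeries.map (LaurentPolynomial.C : ℂ →+* ℂ[T;T⁻¹])) uBiv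

theorem laurentToBiv_toLaurent (p : (PowerSeries ℂ)[X]) :
    laurentToBiv (Polynomial.toLaurent p) = ofPoly p :=
  LaurentPolynomial.eval₂_toLaurent _ _ _

theorem laurentToBiv_T (k : ℤ) : laurentToBiv (LaurentPolynomial.T k) = ((uBiv ^ k : Bivˣ) : Biv) :=
  LaurentPolynomial.eval₂_T _ _ _

theorem map_laurentToBiv_uUnit : Units.map laurentToBiv.toMonoidHom (uUnit (PowerSeries ℂ)) =
    uBiv := by
  ext1
  have := laurentToBiv_T 1
  rw [zpow_one] at this
  exact this

theorem laurentToBiv_C_X :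
    laurentToBiv (LaurentPolynomial.C PowerSeries.X) = PowerSeries.X := by
  rw [laurentToBiv, LaurentPolynomial.eval₂_C, PowerSeries.map_X]

theorem laurentToBiv_kernelLaurent (A : PathAutomaton S σ) :
    laurentToBiv A.kernelLaurent = A.kernel PowerSeries.X uBiv := by
  rw [kernelLaurent, map_kernel, map_laurentToBiv_uUnit, laurentToBiv_C_X]

theorem ofPoly_mul (p q : (PowerSeries ℂ)[X]) : ofPoly (p * q) = ofPoly p * ofPoly q :=
  Polynomial.eval₂_mul _ _

theorem ofPoly_numerator_kernelLaurent (A : PathAutomaton S σ) :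
    ofPoly (numerator A.kernelLaurent) =
      (uBiv : Biv) ^ numeratorExponent A.kernelLaurent * A.kernel PowerSeries.X uBiv := by
  rw [← laurentToBiv_toLaurent, toLaurent_numerator, map_mul, laurentToBiv_kernelLaurent,
    laurentToBiv_T, zpow_natCast, Units.val_pow_eq_pow_val]

/-- The inclusion of the series in `t` alone, as a ring homomorphism. -/
noncomputable def ofPuiseuxHom : HahnSeries ℚ ℂ →+* Ambient where
  toFun := ofPuiseux
  map_one' := HahnSeries.map_one (LaurentPolynomial.C : ℂ →+* ℂ[T;T⁻¹]).toMonoidWithZeroHom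
  map_mul' _ _ := HahnSeries.map_mul
    (LaurentPolynomial.C : ℂ →+* ℂ[T;T⁻¹]).toNonUnitalRingHom
  map_zero' := by ext1; funext; simp [ofPuiseux]
  map_add' _ _ := HahnSeries.map_add (LaurentPolynomial.C : ℂ →+* ℂ[T;T⁻¹]).toAddMonoidHom

theorem ofPuiseuxHom_comp_ofPowerSeries :
    ofPuiseuxHom.comp (HahnSeries.ofPowerSeries ℚ ℂ) =
      ofBiv.comp (PowerSeries.map (LaurentPolynomial.C : ℂ →+* ℂ[T;T⁻¹])) := by
  refine RingHom.ext fun f => HahnSeries.ext (funext fun r => ?_)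
  change LaurentPolynomial.C ((HahnSeries.ofPowerSeries ℚ ℂ f).coeff r) =
    (HahnSeries.ofPowerSeries ℚ ℂ[T;T⁻¹] (PowerSeries.map LaurentPolynomial.C f)).coeff r
  by_cases hr : r ∈ Set.range ((↑) : ℕ → ℚ)
  · obtain ⟨n, rfl⟩ := hr
    rw [HahnSeries.ofPowerSeries_apply_coeff, HahnSeries.ofPowerSeries_apply_coeff,
      PowerSeries.coeff_map]
  · rw [HahnSeries.coeff_ofPowerSeries_of_notMem_range _ hr,
      HahnSeries.coeff_ofPowerSeries_of_notMem_range _ hr, map_zero]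

/-- Evaluate the splitting at `u` in `Ambient`, where both embeddings of the power series in `t`
agree. -/
theorem prod_sub_ofPuiseux (P : (PowerSeries ℂ)[X]) (Y : Multiset (HahnSeries ℚ ℂ))
    (h : P.map (HahnSeries.ofPowerSeries ℚ ℂ) =
      (Y.map fun y => Polynomial.X - Polynomial.C y).prod) :
    (Y.map fun y => ofBiv (uBiv : Biv) - ofPuiseux y).prod = ofBiv (ofPoly P) := by
  have h1 := congrArg (Polynomial.eval₂ ofPuiseuxHom (ofBiv (uBiv : Biv))) h
  rw [Polynomial.eval₂_map, ofPuiseuxHom_comp_ofPowerSeries, ← Polynomial.hom_eval₂,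
    Polynomial.eval₂_multiset_prod, Multiset.map_map] at h1
  refine Eq.trans ?_ h1.symm
  congr 1
  refine Multiset.map_congr rfl fun y _ => ?_
  simp only [Function.comp, Polynomial.eval₂_sub, Polynomial.eval₂_X, Polynomial.eval₂_C]
  rfl

/-- The canonical factorization of the numerator of the kernel: the first factor has exactly the
small roots as its roots. -/
theorem exists_kernel_factorization (hS : ∀ x ∈ S, 0 < x.1) (A : PathAutomaton S σ) :
    ∃ P H : (PowerSeries ℂ)[X],
      (uBiv : Biv) ^ A.smallRoots.card * A.kernel PowerSeries.X uBiv = ofPoly P * ofPoly H ∧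
      P.Monic ∧ P.map PowerSeries.constantCoeff = Polynomial.X ^ A.smallRoots.card ∧
      A.smallRootProduct = ofBiv (ofPoly P) := by
  classical
  set Q := numerator A.kernelLaurent with hQ
  set N := numeratorExponent A.kernelLaurent with hN
  -- Modulo `t` the kernel is `1`, so its numerator reduces to `u ^ N`; this makes `N` the number of
  -- small roots.
  have hQ0 : Q.map PowerSeries.constantCoeff = Polynomial.X ^ N * 1 := by
    ext n
    rw [Polynomial.coeff_map, coeff_numerator, constantCoeff_coeff_kernelLaurent hS, mul_one,
      Polynomial.coeff_X_pow]
    congr 1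
    rw [eq_iff_iff]
    omega
  have hQc : Q.coeff 0 ≠ 0 := by
    refine numerator_coeff_zero_ne_zero _ fun h => ?_
    have := constantCoeff_coeff_kernelLaurent hS A 0
    simp [h] at this
  obtain ⟨P, H, hPH, hP, hPN, hPc, hHc⟩ :=
    exists_monic_factor_of_map_eq_X_pow_mul Q N 1 hQ0 (by simp)
  obtain ⟨Y, hY, hYs⟩ := exists_map_ofPowerSeries_eq_prod P hP N hPc
  have hroots : A.smallRoots = Y := by
    have hnum : numerator A.kernelPuiseux =
        P.map (HahnSeries.ofPowerSeries ℚ ℂ) * H.map (HahnSeries.ofPowerSeries ℚ ℂ) := by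
      rw [← map_kernelLaurent, ← map_numerator _ HahnSeries.ofPowerSeries_injective, ← hQ, hPH,
        Polynomial.map_mul]
    have hne : P.map (HahnSeries.ofPowerSeries ℚ ℂ) * H.map (HahnSeries.ofPowerSeries ℚ ℂ) ≠ 0 := by
      rw [← Polynomial.map_mul, ← hPH,
        Polynomial.map_ne_zero_iff HahnSeries.ofPowerSeries_injective]
      intro h
      simp [h] at hQc
    have hPr : (P.map (HahnSeries.ofPowerSeries ℚ ℂ)).roots = Y := by
      rw [hY, Polynomial.roots_multiset_prod_X_sub_C]
    -- The filter keeps every root of `P` and discards every root of `H`.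
    rw [smallRoots, hnum, Polynomial.roots_mul hne, Multiset.filter_add, hPr,
      Multiset.filter_eq_self.2, Multiset.filter_eq_nil.2, add_zero]
    · rintro y hy ⟨-, -, hpos⟩
      exact HahnSeries.eval_map_ofPowerSeries_ne_zero H hHc y hpos (Polynomial.isRoot_of_mem_roots hy)
    · intro y hy
      refine ⟨?_, hYs y hy⟩
      rintro rfl
      rw [← hPr] at hy
      have h1 := Polynomial.isRoot_of_mem_roots hy
      rw [Polynomial.IsRoot, ← Polynomial.coeff_zero_eq_eval_zero, Polynomial.coeff_map,
        map_eq_zero_iff _ HahnSeries.ofPowerSeries_injective] at h1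
      rw [hPH, Polynomial.mul_coeff_zero, h1, zero_mul] at hQc
      exact hQc rfl
  have hcard : A.smallRoots.card = N := by
    rw [hroots, ← hPN, ← hP.natDegree_map (HahnSeries.ofPowerSeries ℚ ℂ), hY,
      Polynomial.natDegree_multiset_prod_X_sub_C_eq_card]
  refine ⟨P, H, ?_, hP, hcard ▸ hPc, ?_⟩
  · rw [hcard, ← ofPoly_numerator_kernelLaurent, ← ofPoly_mul, ← hPH]
  · rw [smallRootProduct, hroots, prod_sub_ofPuiseux P Y hY]

end PathAutomaton

/-! ### Bounds on the powers of `u`, and the main theorem. -/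

namespace PathAutomaton

section Degree

/-- All powers of `u` in `f` are at most `D`. -/
def HasDegLE (D : ℤ) (f : Biv) : Prop :=
  ∀ (n : ℕ) (k : ℤ), D < k → (PowerSeries.coeff n f).coeff k = 0

/-- No negative powers of `u` occur in `f`. -/
def IsNonneg (f : Biv) : Prop :=
  ∀ (n : ℕ) (k : ℤ), k < 0 → (PowerSeries.coeff n f).coeff k = 0

theorem exists_coeff_ne_zero_of_coeff_mul {R : Type*} [CommRing R] {f g : R[T;T⁻¹]} {k : ℤ}
    (h : (f * g).coeff k ≠ 0) : ∃ i j, i + j = k ∧ f.coeff i ≠ 0 ∧ g.coeff j ≠ 0 := by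
  classical
  have h1 := AddMonoidAlgebra.support_coeff_mul_subset f g (Finsupp.mem_support_iff.2 h)
  obtain ⟨i, hi, j, hj, hij⟩ := Finset.mem_add.1 h1
  exact ⟨i, j, hij, Finsupp.mem_support_iff.1 hi, Finsupp.mem_support_iff.1 hj⟩

theorem coeff_sum_laurent {R ι : Type*} [CommRing R] (s : Finset ι) (f : ι → R[T;T⁻¹]) (k : ℤ) :
    (∑ i ∈ s, f i).coeff k = ∑ i ∈ s, (f i).coeff k := by
  simp

theorem exists_coeff_coeff_ne_zero_of_mul {f g : Biv} {n : ℕ} {k : ℤ}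
    (h : (PowerSeries.coeff n (f * g)).coeff k ≠ 0) :
    ∃ a b i j, i + j = k ∧ (PowerSeries.coeff a f).coeff i ≠ 0 ∧
      (PowerSeries.coeff b g).coeff j ≠ 0 := by
  rw [PowerSeries.coeff_mul, coeff_sum_laurent] at h
  obtain ⟨⟨a, b⟩, -, hab⟩ := Finset.exists_ne_zero_of_sum_ne_zero h
  obtain ⟨i, j, hij, hi, hj⟩ := exists_coeff_ne_zero_of_coeff_mul hab
  exact ⟨a, b, i, j, hij, hi, hj⟩

theorem HasDegLE.mul {D E : ℤ} {f g : Biv} (hf : HasDegLE D f) (hg : HasDegLE E g) :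
    HasDegLE (D + E) (f * g) := by
  intro n k hk
  by_contra h
  obtain ⟨a, b, i, j, hij, hi, hj⟩ := exists_coeff_coeff_ne_zero_of_mul h
  have h1 : i ≤ D := not_lt.1 fun h => hi (hf a i h)
  have h2 : j ≤ E := not_lt.1 fun h => hj (hg b j h)
  omega

theorem IsNonneg.mul {f g : Biv} (hf : IsNonneg f) (hg : IsNonneg g) : IsNonneg (f * g) := by
  intro n k hk
  by_contra h
  obtain ⟨a, b, i, j, hij, hi, hj⟩ := exists_coeff_coeff_ne_zero_of_mul h
  have h1 : 0 ≤ i := not_lt.1 fun h => hi (hf a i h)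
  have h2 : 0 ≤ j := not_lt.1 fun h => hj (hg b j h)
  omega

theorem exists_hasDegLE_sum {ι : Type*} (s : Finset ι) (f : ι → Biv)
    (h : ∀ i ∈ s, ∃ D, HasDegLE D (f i)) : ∃ D, HasDegLE D (∑ i ∈ s, f i) := by
  choose! D hD using h
  rcases s.eq_empty_or_nonempty with rfl | hs
  · exact ⟨0, fun n k _ => by simp⟩
  refine ⟨s.sup' hs D, fun n k hk => ?_⟩
  rw [map_sum, coeff_sum_laurent]
  exact Finset.sum_eq_zero fun i hi => hD i hi n k ((Finset.le_sup' D hi).trans_lt hk)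

theorem coeff_coeff_laurentToBiv (L : (PowerSeries ℂ)[T;T⁻¹]) (n : ℕ) (k : ℤ) :
    (PowerSeries.coeff n (laurentToBiv L)).coeff k = PowerSeries.coeff n (L.coeff k) := by
  induction L using LaurentPolynomial.induction_on' with
  | add p q hp hq => simp [hp, hq]
  | C_mul_T m a =>
    rw [map_mul, laurentToBiv_T, val_uBiv_zpow, laurentToBiv, LaurentPolynomial.eval₂_C,
      PowerSeries.coeff_mul_C, PowerSeries.coeff_map, mul_comm, coeff_T_mul,
      mul_comm (LaurentPolynomial.C a), coeff_T_mul, LaurentPolynomial.C_apply,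
      LaurentPolynomial.C_apply]
    split_ifs <;> simp

theorem exists_hasDegLE_laurentToBiv (L : (PowerSeries ℂ)[T;T⁻¹]) :
    ∃ D, HasDegLE D (laurentToBiv L) := by
  obtain ⟨D, hD⟩ := L.coeff.support.bddAbove
  refine ⟨D, fun n k hk => ?_⟩
  rw [coeff_coeff_laurentToBiv, Finsupp.notMem_support_iff.1, map_zero]
  exact fun h => absurd (hD h) (not_le.2 hk)

theorem isNonneg_ofPoly (p : (PowerSeries ℂ)[X]) : IsNonneg (ofPoly p) := by
  intro n k hk
  rw [← laurentToBiv_toLaurent, coeff_coeff_laurentToBiv, coeff_toLaurent_of_neg _ hk, map_zero]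

theorem coeff_coeff_ofPoly (p : (PowerSeries ℂ)[X]) (n k : ℕ) :
    (PowerSeries.coeff n (ofPoly p)).coeff (k : ℤ) = PowerSeries.coeff n (p.coeff k) := by
  rw [← laurentToBiv_toLaurent, coeff_coeff_laurentToBiv, coeff_toLaurent_natCast]

/-- The bound is uniform in the power of `t`, so collecting by powers of `u` leaves finitely many
power series. -/
theorem exists_ofPoly_eq {f : Biv} (hf : IsNonneg f) {D : ℤ} (hD : HasDegLE D f) :
    ∃ p, ofPoly p = f := by
  refine ⟨∑ i ∈ Finset.range (D.toNat + 1), Polynomial.C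
    (PowerSeries.mk fun n => (PowerSeries.coeff n f).coeff (i : ℤ)) * Polynomial.X ^ i, ?_⟩
  ext n k
  by_cases hk : k < 0
  · rw [hf n k hk, isNonneg_ofPoly _ n k hk]
  · lift k to ℕ using not_lt.1 hk
    rw [coeff_coeff_ofPoly]
    simp only [Polynomial.finsetSum_coeff, Polynomial.coeff_C_mul_X_pow, Finset.sum_ite_eq,
      Finset.mem_range]
    split_ifs with h
    · rw [PowerSeries.coeff_mk]
    · rw [hD n k (by omega), map_zero]

theorem hasDegLE_ofPoly (p : (PowerSeries ℂ)[X]) : HasDegLE p.natDegree (ofPoly p) := by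
  intro n k hk
  lift k to ℕ using by omega
  rw [coeff_coeff_ofPoly, Polynomial.coeff_eq_zero_of_natDegree_lt (by omega), map_zero]

/-- Division by a distinguished polynomial lowers the degree in `u`. -/
theorem HasDegLE.of_mul_ofPoly {f : Biv} {P : (PowerSeries ℂ)[X]} {e : ℕ} {D : ℤ}
    (hP : P.natDegree = e) (hPm : P.map PowerSeries.constantCoeff = Polynomial.X ^ e)
    (h : HasDegLE D (f * ofPoly P)) : HasDegLE (D - e) f := by
  have hP0 : PowerSeries.coeff 0 (ofPoly P) = LaurentPolynomial.T e := by
    ext k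
    by_cases hk : k < 0
    · rw [isNonneg_ofPoly P 0 k hk, LaurentPolynomial.T_apply, if_neg (by omega)]
    · lift k to ℕ using not_lt.1 hk
      rw [coeff_coeff_ofPoly, PowerSeries.coeff_zero_eq_constantCoeff_apply,
        ← Polynomial.coeff_map, hPm, Polynomial.coeff_X_pow, LaurentPolynomial.T_apply]
      simp [eq_comm]
  have hPd := hasDegLE_ofPoly P
  rw [hP] at hPd
  intro n
  induction n using Nat.strong_induction_on with
  | _ n ih =>
  intro k hk
  have h1 := h n (k + e) (by omega)
  -- At `t ^ n * u ^ (k + e)`, the leading part `u ^ e` of `P` picks out the coefficient of `u ^ k`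
  -- in `f`. The other terms involve earlier coefficients of `f`, so by induction their degree is at
  -- most `(D - e) + e < k + e`.
  rw [PowerSeries.coeff_mul, coeff_sum_laurent, Finset.sum_eq_single (n, 0)] at h1
  · rw [hP0, mul_comm, coeff_T_mul, add_sub_cancel_right] at h1
    exact h1
  · rintro ⟨a, b⟩ hab hne
    rw [Finset.HasAntidiagonal.mem_antidiagonal] at hab
    by_contra hc
    obtain ⟨i, j, hij, hi, hj⟩ := exists_coeff_ne_zero_of_coeff_mul hc
    have ha : a < n := by
      rcases Nat.eq_zero_or_pos b with rfl | hb
      · exact absurd (by simpa using hab) hne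
      · simp only at hab; omega
    have h2 : i ≤ D - e := not_lt.1 fun h => hi (ih a ha i h)
    have h3 : j ≤ e := not_lt.1 fun h => hj (hPd b j h)
    omega
  · simp

end Degree

variable {S : Finset (ℤ × ℤ)} {σ : Type*}

theorem isNonneg_genFun (hS : ∀ x ∈ S, 0 < x.1) {P : List S → Prop}
    (hP : ∀ w, P w → 0 ≤ altitude w) : IsNonneg (genFun P) := by
  classical
  intro n k hk
  rw [coeff_genFun hS, coeff_sum_laurent]
  refine Finset.sum_eq_zero fun w _ => ?_
  split_ifs with h
  · have := hP w h
    rw [LaurentPolynomial.T_apply, if_neg (by omega)]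
  · simp

theorem isNonneg_meanderGF (hS : ∀ x ∈ S, 0 < x.1) (A : PathAutomaton S σ) :
    IsNonneg A.meanderGF :=
  isNonneg_genFun hS fun _ h => h.1.altitude_nonneg

variable [Fintype σ] [DecidableEq σ]

theorem hasDegLE_forbiddenVector (A : PathAutomaton S σ) (q : σ) :
    HasDegLE 0 (A.forbiddenVector q) := by
  intro n k hk
  have h1 : (PowerSeries.coeff n ((Pi.single A.start 1 : σ → Biv) q)).coeff k = 0 := by
    by_cases hq : q = A.start
    · subst hq
      rw [Pi.single_eq_same, PowerSeries.coeff_one]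
      split_ifs
      · rw [← LaurentPolynomial.T_zero, LaurentPolynomial.T_apply, if_neg hk.ne]
      · simp
    · simp [hq]
  rw [forbiddenVector, map_sub, AddMonoidAlgebra.coeff_sub, Finsupp.sub_apply, h1, zero_sub,
    negPart, PowerSeries.coeff_mk, neg_eq_zero]
  exact Finsupp.filter_apply_neg _ _ (not_lt.2 hk.le)

/-- The adjugate is already defined over Laurent polynomials in `u` with coefficients in `ℂ⟦t⟧`,
whose supports in `u` are finite. -/
theorem exists_hasDegLE_adjVector (A : PathAutomaton S σ) (q : σ) :
    ∃ D, HasDegLE D (A.adjVector q) := by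
  have h : 1 - A.adjMatrix PowerSeries.X uBiv = laurentToBiv.mapMatrix
      (1 - A.adjMatrix (LaurentPolynomial.C PowerSeries.X) (uUnit _)) := by
    rw [map_sub, map_one, RingHom.mapMatrix_apply, map_adjMatrix, map_laurentToBiv_uUnit,
      laurentToBiv_C_X]
  rw [adjVector, h, ← RingHom.map_adjugate]
  refine exists_hasDegLE_sum _ _ fun p _ => ?_
  rw [mul_one]
  exact exists_hasDegLE_laurentToBiv _

theorem exists_hasDegLE_dotProduct (A : PathAutomaton S σ) :
    ∃ D, HasDegLE D (A.forbiddenVector ⬝ᵥ A.adjVector) := by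
  refine exists_hasDegLE_sum _ _ fun p _ => ?_
  obtain ⟨D, hD⟩ := A.exists_hasDegLE_adjVector p
  exact ⟨_, (A.hasDegLE_forbiddenVector p).mul hD⟩

theorem isUnit_kernel (hS : ∀ x ∈ S, 0 < x.1) (A : PathAutomaton S σ) :
    IsUnit (A.kernel PowerSeries.X uBiv) := by
  rw [PowerSeries.isUnit_iff_constantCoeff, map_kernel, PowerSeries.constantCoeff_X,
    kernel_zero hS]
  exact isUnit_one

end PathAutomaton

theorem theorem2 {σ : Type*} [Fintype σ] [DecidableEq σ] (S : Finset (ℤ × ℤ))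
    (hS : ∀ x ∈ S, 0 < x.1) (A : PathAutomaton S σ) (e : ℕ) (he : e = A.smallRoots.card)
    (K : PathAutomaton.Biv) (hK : K = A.kernel PowerSeries.X PathAutomaton.uBiv) :
    IsUnit K ∧
    ∃ G : Polynomial (PowerSeries ℂ),
      PathAutomaton.ofBiv A.meanderGF *
          PathAutomaton.ofBiv ((PathAutomaton.uBiv : PathAutomaton.Biv) ^ e * K) =
        PathAutomaton.ofBiv (PathAutomaton.ofPoly G) * A.smallRootProduct ∧
      PathAutomaton.ofBiv ((PathAutomaton.uBiv : PathAutomaton.Biv) ^ e *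
          (A.forbiddenVector ⬝ᵥ A.adjVector)) =
        PathAutomaton.ofBiv (PathAutomaton.ofPoly G) * A.smallRootProduct := by
  subst he hK
  refine ⟨A.isUnit_kernel hS, ?_⟩
  obtain ⟨P, H, hPH, hP, hPc, hprod⟩ := A.exists_kernel_factorization hS
  have hdeg : P.natDegree = A.smallRoots.card := by
    rw [← hP.natDegree_map PowerSeries.constantCoeff, hPc, Polynomial.natDegree_X_pow]
  have hmul : A.meanderGF * ((PathAutomaton.uBiv : PathAutomaton.Biv) ^ A.smallRoots.card *
      A.kernel PowerSeries.X PathAutomaton.uBiv) =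
        A.meanderGF * PathAutomaton.ofPoly H * PathAutomaton.ofPoly P := by
    rw [hPH]; ring
  have hadj : (PathAutomaton.uBiv : PathAutomaton.Biv) ^ A.smallRoots.card *
      (A.forbiddenVector ⬝ᵥ A.adjVector) =
        A.meanderGF * PathAutomaton.ofPoly H * PathAutomaton.ofPoly P := by
    rw [← hmul, A.forbiddenVector_dotProduct_adjVector hS]; ring
  obtain ⟨D, hD⟩ := A.exists_hasDegLE_dotProduct
  have hu : PathAutomaton.HasDegLE A.smallRoots.card
      ((PathAutomaton.uBiv : PathAutomaton.Biv) ^ A.smallRoots.card) := by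
    have h1 := PathAutomaton.hasDegLE_ofPoly (Polynomial.X ^ A.smallRoots.card)
    rwa [Polynomial.natDegree_X_pow, PathAutomaton.ofPoly, Polynomial.eval₂_X_pow] at h1
  have hbound := hu.mul hD
  rw [hadj] at hbound
  -- The witness is `M * H`: nonnegativity comes from its factors, the degree bound from `u ^ e * F
  -- · adj(I - A) · 1` after division by `P`.
  obtain ⟨G, hG⟩ := PathAutomaton.exists_ofPoly_eq
    ((A.isNonneg_meanderGF hS).mul (PathAutomaton.isNonneg_ofPoly H))
    (hbound.of_mul_ofPoly hdeg hPc)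
  refine ⟨G, ?_, ?_⟩
  · rw [← map_mul, hmul, hprod, hG, map_mul]
  · rw [hadj, hprod, hG, map_mul]
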